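/- Let $H$ be a real separable Hilbert space, let $A\colon \mathcal D(A)\subset H\to H$ be a densely defined, self-adjoint, positive definite (possibly unbounded) linear operator with compact inverse, and let $0<T<\infty$. Let $V:=\mathcal D(A^{1/2})$ with inner product $\langle\varphi,\psi\rangle_V:=\langle A^{1/2}\varphi,A^{1/2}\psi\rangle_H$, let $V^*$ be its dual with the dual norm and with duality pairing ${}_V\langle\cdot,\cdot\rangle_{V^*}$, where $V\hookrightarrow H\cong H^*\hookrightarrow V^*$, and let $A^*\in\mathcal L(V;V^*)$ be given by ${}_V\langle\varphi,A^*\psi\rangle_{V^*}=\langle\varphi,\psi\rangle_V$. Put $$\mathcal X:=L^2(0,T;V),\qquad \mathcal Y:=\{v\in L^2(0,T;V):\ \partial_t v\in L^2(0,T;V^*),\ v(T)=0\},$$ where $\partial_t$ is the weak time derivative and $v(T)$ is the value at $T$ of the continuous $V^*$-valued representative of $v$, with the norms $$\|u\|_{\mathcal X}^2=\int_0^T\|u(t)\|_V^2\,dt,\qquad \|v\|_{\mathcal Y}^2=\int_0^T\|v(t)\|_V^2\,dt+\int_0^T\|\partial_t v(t)\|_{V^*}^2\,dt,$$ and define the bilinear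 form $$\mathcal B(u,v):=\int_0^T {}_V\langle u(t),(-\partial_t+A^*)v(t)\rangle_{V^*}\,dt,\qquad u\in\mathcal X,\ v\in\mathcal Y.$$ Then the inf-sup constant $$\beta:=\inf_{u\in\mathcal X\setminus\{0\}}\ \sup_{v\in\mathcal Y\setminus\{0\}}\frac{\mathcal B(u,v)}{\|u\|_{\mathcal X}\,\|v\|_{\mathcal Y}}$$ satisfies $\beta\ge 1$ (with the convention $\inf\emptyset=+\infty$, which matters only for $H=\{0\}$). -/

import Mathlib

open MeasureTheory Set
open scoped ContDiff RealInnerProductSpace ENNReal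

noncomputable section

namespace SpaceTimeParabolic

universe u

/-! ### The operator `A`, its square root and the space `V` -/

section Operator

variable {H : Type u} [NormedAddCommGroup H] [InnerProductSpace ℝ H]

/-- `K` is the (everywhere defined, bounded) inverse of the unbounded operator `A`. -/
def IsBoundedInverse (A : H →ₗ.[ℝ] H) (K : H →L[ℝ] H) : Prop :=
  (∀ y : H, ∃ h : K y ∈ A.domain, A ⟨K y, h⟩ = y) ∧ ∀ x : A.domain, K (A x) = x

/-- A positive square root acts on an eigenvector of `K` by the root of the eigenvalue. -/
theorem posSqrt_apply_eigenvector {K R : H →L[ℝ] H} (hR : R.IsPositive) (hRK : R ∘L R = K)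
    {e : H} {m : ℝ} (he : K e = m • e) : R e = √m • e := by
  by_cases he0 : e = 0
  · simp [he0]
  have hsym : ∀ x y, ⟪R x, y⟫ = ⟪x, R y⟫ := hR.isSymmetric
  have hpos : ∀ x, 0 ≤ ⟪R x, x⟫ := fun x => by
    simpa using hR.re_inner_nonneg_left x
  have hRR : R (R e) = m • e := by rw [← he, ← hRK]; rfl
  have hm : 0 ≤ m := by
    have h1 : ⟪R (R e), e⟫ = ⟪R e, R e⟫ := hsym _ _
    rw [hRR, inner_smul_left, real_inner_self_eq_norm_sq, real_inner_self_eq_norm_sq] at h1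
    have : 0 < ‖e‖ ^ 2 := by positivity
    by_contra hlt
    push Not at hlt
    have h2 : m * ‖e‖ ^ 2 < 0 := mul_neg_of_neg_of_pos hlt this
    have h3 : 0 ≤ ‖R e‖ ^ 2 := by positivity
    simp at h1
    linarith
  set d := R e - √m • e with hd
  have h1 : R d = -(√m • d) := by
    rw [hd, map_sub, map_smul, hRR, smul_sub, smul_smul, Real.mul_self_sqrt hm]
    abel
  have h2 : ⟪R d, d⟫ = -(√m * ‖d‖ ^ 2) := by
    rw [h1, inner_neg_left, inner_smul_left, real_inner_self_eq_norm_sq]; simp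
  have h3 := hpos d
  have h4 : √m * ‖d‖ ^ 2 = 0 := by
    have : 0 ≤ √m * ‖d‖ ^ 2 := by positivity
    linarith
  rcases mul_eq_zero.1 h4 with h5 | h5
  · have h6 : ⟪R (R e), e⟫ = ⟪R e, R e⟫ := hsym _ _
    have hm0 : m = 0 := le_antisymm (Real.sqrt_eq_zero'.1 h5) hm
    rw [hRR, hm0, zero_smul, inner_zero_left, real_inner_self_eq_norm_sq] at h6
    have : ‖R e‖ = 0 := by
      have := h6.symm
      simpa using this
    rw [h5, zero_smul]
    exact norm_eq_zero.1 this
  · have : d = 0 := by simpa using h5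
    exact sub_eq_zero.1 this

variable [CompleteSpace H]

/-- `A : D(A) ⊆ H → H` is densely defined, self-adjoint, positive definite and has a compact
inverse. -/
structure IsAdmissible (A : H →ₗ.[ℝ] H) : Prop where
  dense : Dense (A.domain : Set H)
  selfAdjoint : IsSelfAdjoint A
  posDef : ∀ x : A.domain, (x : H) ≠ 0 → 0 < ⟪A x, (x : H)⟫
  compactInverse : ∃ K : H →L[ℝ] H, IsCompactOperator K ∧ IsBoundedInverse A K

/-- A compact symmetric operator has a Hilbert basis of eigenvectors. -/
theorem exists_eigenbasis {K : H →L[ℝ] H} (hK : IsCompactOperator K)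
    (hs : (K : H →ₗ[ℝ] H).IsSymmetric) :
    ∃ (ι : Type u) (b : HilbertBasis ι ℝ H) (m : ι → ℝ), ∀ i, K (b i) = m i • b i := by
  classical
  let E : ℝ → Submodule ℝ H := fun μ => Module.End.eigenspace (K : H →ₗ[ℝ] H) μ
  have hcl : ∀ μ, IsClosed (E μ : Set H) := by
    intro μ
    have : (E μ : Set H) = {x | K x = μ • x} := by
      ext x
      simp [E]
    rw [this]
    exact isClosed_eq K.continuous (continuous_const_smul μ)
  have hcs : ∀ μ, CompleteSpace (E μ) := fun μ => (hcl μ).completeSpace_coe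
  choose w b hb using fun μ => exists_hilbertBasis ℝ (E μ)
  have hort := (hs.orthogonalFamily_eigenspaces).orthonormal_sigma_orthonormal
    (v_family := fun μ => b μ) (fun μ => (b μ).orthonormal)
  have hbot : (Submodule.span ℝ (range
      (fun a : Σ μ, w μ => ((b a.1 a.2 : E a.1) : H))))ᗮ = ⊥ := by
    rw [Submodule.eq_bot_iff]
    intro x hx
    have hx' : x ∈ (⨆ μ, E μ)ᗮ := by
      rw [Submodule.mem_orthogonal]
      intro y hy
      induction hy using Submodule.iSup_induction' with
      | mem μ z hz =>
        have hz' := (b μ).hasSum_repr ⟨z, hz⟩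
        have h2 := (hz'.mapL (E μ).subtypeL).mapL (innerSL ℝ x)
        have h3 : ∀ i, ((innerSL ℝ x) ((E μ).subtypeL
            ((b μ).repr ⟨z, hz⟩ i • b μ i)) : ℝ) = 0 := by
          intro i
          have h4 : ⟪((b μ i : E μ) : H), x⟫ = 0 :=
            (Submodule.mem_orthogonal _ _).1 hx _ (Submodule.subset_span ⟨⟨μ, i⟩, rfl⟩)
          rw [real_inner_comm] at h4
          simp [h4]
        have h5 := h2.unique (by simpa only [h3] using hasSum_zero)
        rw [real_inner_comm]
        simpa using h5
      | zero => simp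
      | add y z _ _ hy hz => rw [inner_add_left, hy, hz, add_zero]
    rw [ContinuousLinearMap.orthogonalComplement_iSup_eigenspaces_eq_bot hK hs] at hx'
    simpa using hx'
  refine ⟨_, HilbertBasis.mkOfOrthogonalEqBot hort hbot, fun a => a.1, fun a => ?_⟩
  have h1 : HilbertBasis.mkOfOrthogonalEqBot hort hbot a = ((b a.1 a.2 : E a.1) : H) :=
    congrFun (HilbertBasis.coe_mkOfOrthogonalEqBot hort hbot) a
  have h2 := Module.End.mem_eigenspace_iff.1 (b a.1 a.2 : E a.1).2
  rw [← h1] at h2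
  exact h2

/-- A compact positive operator has exactly one positive square root. -/
theorem existsUnique_posSqrt {K : H →L[ℝ] H} (hK : IsCompactOperator K) (hp : K.IsPositive) :
    ∃! R : H →L[ℝ] H, R.IsPositive ∧ R ∘L R = K := by
  obtain ⟨ι, b, m, hb⟩ := exists_eigenbasis hK hp.isSymmetric
  have hm : ∀ i, 0 ≤ m i := by
    intro i
    have h1 : 0 ≤ ⟪K (b i), b i⟫ := by simpa using hp.re_inner_nonneg_left (b i)
    rw [hb, inner_smul_left, real_inner_self_eq_norm_sq, b.orthonormal.1 i] at h1
    simpa using h1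
  have hmK : ∀ i, m i ≤ ‖K‖ := by
    intro i
    have h1 := K.le_opNorm (b i)
    rw [hb, norm_smul, b.orthonormal.1 i, Real.norm_eq_abs, abs_of_nonneg (hm i)] at h1
    simpa using h1
  have hsq : ∀ i, √(m i) ≤ √‖K‖ := fun i => Real.sqrt_le_sqrt (hmK i)
  have hle : ∀ (f : lp (fun _ : ι => ℝ) 2) i,
      ‖√(m i) * f i‖ ≤ ‖(√‖K‖ • f) i‖ := by
    intro f i
    simp only [lp.coeFn_smul, Pi.smul_apply, smul_eq_mul, norm_mul, Real.norm_eq_abs,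
      abs_of_nonneg (Real.sqrt_nonneg _)]
    exact mul_le_mul_of_nonneg_right (hsq i) (abs_nonneg _)
  have hmem : ∀ f : lp (fun _ : ι => ℝ) 2, Memℓp (fun i => √(m i) * f i) 2 := fun f =>
    (lp.memℓp (√‖K‖ • f)).mono' (hle f)
  let Dl : lp (fun _ : ι => ℝ) 2 →ₗ[ℝ] lp (fun _ : ι => ℝ) 2 :=
    { toFun := fun f => ⟨fun i => √(m i) * f i, hmem f⟩
      map_add' := fun f g => by
        ext i
        exact mul_add _ _ _
      map_smul' := fun c f => by
        ext i
        exact mul_left_comm _ _ _ }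
  have hDl : ∀ f i, Dl f i = √(m i) * f i := fun _ _ => rfl
  let D : lp (fun _ : ι => ℝ) 2 →L[ℝ] lp (fun _ : ι => ℝ) 2 :=
    Dl.mkContinuous (√‖K‖) fun f => by
      have h := lp.norm_mono (p := 2) (x := Dl f) (y := √‖K‖ • f) (by norm_num) (hle f)
      rwa [norm_smul, Real.norm_eq_abs, abs_of_nonneg (Real.sqrt_nonneg _)] at h
  have hD : ∀ f i, D f i = √(m i) * f i := fun _ _ => rfl
  let R : H →L[ℝ] H :=
    (b.repr.symm.toContinuousLinearEquiv : lp (fun _ : ι => ℝ) 2 →L[ℝ] H) ∘L D ∘L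
      (b.repr.toContinuousLinearEquiv : H →L[ℝ] lp (fun _ : ι => ℝ) 2)
  have hRrepr : ∀ x i, b.repr (R x) i = √(m i) * b.repr x i := by
    intro x i
    have : b.repr (R x) = D (b.repr x) := by simp [R]
    rw [this, hD]
  have hKrepr : ∀ x i, b.repr (K x) i = m i * b.repr x i := by
    intro x i
    have h1 : ⟪K (b i), x⟫ = ⟪b i, K x⟫ := hp.isSymmetric _ _
    rw [b.repr_apply_apply, b.repr_apply_apply, ← h1, hb, inner_smul_left]
    simp
  have hinner : ∀ x y, ⟪x, y⟫ = ∑' i, ⟪b.repr x i, b.repr y i⟫ := fun x y => by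
    rw [← b.repr.inner_map_map, lp.inner_eq_tsum]
  have hRpos : R.IsPositive := by
    rw [ContinuousLinearMap.isPositive_def]
    refine ⟨fun x y => ?_, fun x => ?_⟩
    · change ⟪R x, y⟫ = ⟪x, R y⟫
      rw [hinner, hinner]
      refine tsum_congr fun i => ?_
      simp only [hRrepr, RCLike.inner_apply, conj_trivial]
      ring
    · rw [ContinuousLinearMap.reApplyInnerSelf_apply]
      change 0 ≤ RCLike.re ⟪R x, x⟫
      rw [hinner]
      refine tsum_nonneg fun i => ?_
      simp only [hRrepr, RCLike.inner_apply, conj_trivial]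
      have := Real.sqrt_nonneg (m i)
      nlinarith [mul_nonneg this (sq_nonneg (b.repr x i))]
  refine ⟨R, ⟨hRpos, ?_⟩, ?_⟩
  · ext x
    apply b.repr.injective
    ext i
    change b.repr (R (R x)) i = _
    rw [hRrepr, hRrepr, hKrepr, ← mul_assoc, Real.mul_self_sqrt (hm i)]
  · rintro S ⟨hS, hSK⟩
    ext x
    apply b.repr.injective
    ext i
    have h1 : ⟪S (b i), x⟫ = ⟪b i, S x⟫ := hS.isSymmetric _ _
    rw [hRrepr, b.repr_apply_apply, b.repr_apply_apply, ← h1,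
      posSqrt_apply_eigenvector hS hSK (hb i), inner_smul_left]
    simp

variable {A : H →ₗ.[ℝ] H}

/-- The bounded inverse `A⁻¹`. -/
def inverseOp (hA : IsAdmissible A) : H →L[ℝ] H := hA.compactInverse.choose

theorem inverseOp_compact (hA : IsAdmissible A) : IsCompactOperator (inverseOp hA) :=
  hA.compactInverse.choose_spec.1

theorem inverseOp_spec (hA : IsAdmissible A) : IsBoundedInverse A (inverseOp hA) :=
  hA.compactInverse.choose_spec.2

theorem inverseOp_isPositive (hA : IsAdmissible A) : (inverseOp hA).IsPositive := by
  obtain ⟨h1, -⟩ := inverseOp_spec hA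
  have hfa : A.IsFormalAdjoint A := by
    have := LinearPMap.adjoint_isFormalAdjoint hA.dense
    rwa [LinearPMap.isSelfAdjoint_def.1 hA.selfAdjoint] at this
  rw [ContinuousLinearMap.isPositive_def]
  refine ⟨fun x y => ?_, fun x => ?_⟩
  · change ⟪inverseOp hA x, y⟫ = ⟪x, inverseOp hA y⟫
    obtain ⟨hx, hx'⟩ := h1 x
    obtain ⟨hy, hy'⟩ := h1 y
    have := hfa ⟨_, hx⟩ ⟨_, hy⟩
    rw [hx', hy'] at this
    exact this.symm
  · rw [ContinuousLinearMap.reApplyInnerSelf_apply]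
    change 0 ≤ ⟪inverseOp hA x, x⟫
    obtain ⟨hx, hx'⟩ := h1 x
    by_cases h0 : inverseOp hA x = 0
    · simp [h0]
    · have := hA.posDef ⟨_, hx⟩ h0
      rw [hx', real_inner_comm] at this
      exact this.le

/-- `A^{-1/2}`, the unique positive square root of `A⁻¹`. -/
def invSqrt (hA : IsAdmissible A) : H →L[ℝ] H :=
  (existsUnique_posSqrt (inverseOp_compact hA) (inverseOp_isPositive hA)).choose

theorem invSqrt_isPositive (hA : IsAdmissible A) : (invSqrt hA).IsPositive :=
  (existsUnique_posSqrt (inverseOp_compact hA) (inverseOp_isPositive hA)).choose_spec.1.1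

theorem invSqrt_comp_self (hA : IsAdmissible A) : invSqrt hA ∘L invSqrt hA = inverseOp hA :=
  (existsUnique_posSqrt (inverseOp_compact hA) (inverseOp_isPositive hA)).choose_spec.1.2

theorem invSqrt_injective (hA : IsAdmissible A) : Function.Injective (invSqrt hA) := by
  have hinj : Function.Injective (inverseOp hA) := by
    intro x y hxy
    obtain ⟨hx, hx'⟩ := (inverseOp_spec hA).1 x
    obtain ⟨hy, hy'⟩ := (inverseOp_spec hA).1 y
    rw [← hx', ← hy']
    congr 1
    exact Subtype.ext hxy
  intro x y hxy
  apply hinj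
  rw [← invSqrt_comp_self hA]
  exact congrArg (invSqrt hA) hxy

/-- The space `V = D(A^{1/2})`, the range of `A^{-1/2}`. -/
def FormSpace (hA : IsAdmissible A) : Type _ :=
  LinearMap.range (invSqrt hA : H →ₗ[ℝ] H)

section Aux

/-- The vector space structure of `D(A^{1/2}) ⊆ H`. -/
@[reducible] def FormSpace.addCommGroup (hA : IsAdmissible A) : AddCommGroup (FormSpace hA) :=
  inferInstanceAs (AddCommGroup (LinearMap.range (invSqrt hA : H →ₗ[ℝ] H)))

attribute [local instance] FormSpace.addCommGroup

/-- The vector space structure of `D(A^{1/2}) ⊆ H`. -/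
@[reducible] def FormSpace.module (hA : IsAdmissible A) : Module ℝ (FormSpace hA) :=
  inferInstanceAs (Module ℝ (LinearMap.range (invSqrt hA : H →ₗ[ℝ] H)))

attribute [local instance] FormSpace.module

/-- `A^{1/2} : D(A^{1/2}) → H`, the inverse of `A^{-1/2}`. -/
def sqrtEquiv (hA : IsAdmissible A) : FormSpace hA ≃ₗ[ℝ] H :=
  (LinearEquiv.ofInjective (invSqrt hA : H →ₗ[ℝ] H) (invSqrt_injective hA)).symm

/-- `V` carries the norm `‖A^{1/2} φ‖_H`. -/
instance FormSpace.normedAddCommGroup (hA : IsAdmissible A) : NormedAddCommGroup (FormSpace hA) :=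
  NormedAddCommGroup.induced (FormSpace hA) H (sqrtEquiv hA : FormSpace hA →ₗ[ℝ] H)
    (sqrtEquiv hA).injective

/-- `V` carries the inner product `⟪A^{1/2} φ, A^{1/2} ψ⟫_H`. -/
instance FormSpace.innerProductSpace (hA : IsAdmissible A) :
    InnerProductSpace ℝ (FormSpace hA) where
  __ := FormSpace.module hA
  norm_smul_le c φ := by
    change ‖sqrtEquiv hA (c • φ)‖ ≤ ‖c‖ * ‖sqrtEquiv hA φ‖
    rw [map_smul, norm_smul]
  inner φ ψ := ⟪sqrtEquiv hA φ, sqrtEquiv hA ψ⟫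
  norm_sq_eq_re_inner φ := norm_sq_eq_re_inner (𝕜 := ℝ) (sqrtEquiv hA φ)
  conj_inner_symm φ ψ := inner_conj_symm (𝕜 := ℝ) (sqrtEquiv hA φ) (sqrtEquiv hA ψ)
  add_left φ ψ χ := by
    change ⟪sqrtEquiv hA (φ + ψ), sqrtEquiv hA χ⟫ = _
    rw [map_add]
    exact inner_add_left _ _ _
  smul_left φ ψ c := by
    change ⟪sqrtEquiv hA (c • φ), sqrtEquiv hA ψ⟫ = _
    rw [map_smul]
    exact inner_smul_left _ _ _

end Aux

/-- `A^{1/2} : V → H`. -/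
def sqrtOp (hA : IsAdmissible A) : FormSpace hA ≃ₗ[ℝ] H := sqrtEquiv hA

theorem FormSpace.norm_def (hA : IsAdmissible A) (φ : FormSpace hA) : ‖φ‖ = ‖sqrtOp hA φ‖ := rfl

theorem FormSpace.inner_def (hA : IsAdmissible A) (φ ψ : FormSpace hA) :
    ⟪φ, ψ⟫ = ⟪sqrtOp hA φ, sqrtOp hA ψ⟫ := rfl

/-- `D(A^{1/2})` is already complete, hence equal to its completion. -/
instance (hA : IsAdmissible A) : CompleteSpace (FormSpace hA) :=
  let e : FormSpace hA ≃ₗᵢ[ℝ] H := ⟨sqrtOp hA, fun _ => rfl⟩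
  (completeSpace_congr (e := e.toEquiv) e.isometry.isUniformEmbedding).2 inferInstance

/-- The inclusion `D(A^{1/2}) ⊆ H` as a linear map. -/
def inclusion (hA : IsAdmissible A) : FormSpace hA →ₗ[ℝ] H :=
  (LinearMap.range (invSqrt hA : H →ₗ[ℝ] H)).subtype

theorem invSqrt_sqrtOp (hA : IsAdmissible A) (φ : FormSpace hA) :
    invSqrt hA (sqrtOp hA φ) = inclusion hA φ :=
  congrArg Subtype.val ((sqrtOp hA).symm_apply_apply φ)

/-- The continuous embedding `V ↪ H`. -/
def toPivot (hA : IsAdmissible A) : FormSpace hA →L[ℝ] H :=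
  LinearMap.mkContinuous (inclusion hA) ‖invSqrt hA‖ fun φ => by
    rw [FormSpace.norm_def, ← invSqrt_sqrtOp]
    exact (invSqrt hA).le_opNorm _

/-- `V*`, the dual of `V`, with the dual norm. -/
abbrev FormDual (hA : IsAdmissible A) : Type _ := FormSpace hA →L[ℝ] ℝ

/-- The embedding `V ↪ H ≅ H* ↪ V*`, `φ ↦ ⟪φ, ·⟫_H`. -/
def toDual (hA : IsAdmissible A) : FormSpace hA →L[ℝ] FormDual hA :=
  LinearMap.mkContinuous₂
    (((innerₗ H).compl₁₂ (toPivot hA : FormSpace hA →ₗ[ℝ] H)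
      (toPivot hA : FormSpace hA →ₗ[ℝ] H))) (‖toPivot hA‖ * ‖toPivot hA‖) fun φ ψ => by
    have h1 := norm_inner_le_norm (𝕜 := ℝ) (toPivot hA φ) (toPivot hA ψ)
    have h2 := mul_le_mul ((toPivot hA).le_opNorm φ) ((toPivot hA).le_opNorm ψ)
      (norm_nonneg _) (by positivity)
    exact (h1.trans h2).trans (le_of_eq (by ring))

/-- `A ∈ L(V; V*)`, `⟨A φ, ψ⟩ = ⟪A^{1/2} φ, A^{1/2} ψ⟫_H`. -/
def formOp (hA : IsAdmissible A) : FormSpace hA →L[ℝ] FormDual hA :=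
  LinearMap.mkContinuous₂
    ((innerₗ H).compl₁₂ (sqrtOp hA : FormSpace hA →ₗ[ℝ] H) (sqrtOp hA : FormSpace hA →ₗ[ℝ] H))
    1 fun φ ψ => by
      rw [one_mul]
      exact norm_inner_le_norm (𝕜 := ℝ) (sqrtOp hA φ) (sqrtOp hA ψ)

/-- The adjoint `A* ∈ L(V; V*)`, `⟨φ, A* ψ⟩ = ⟨A φ, ψ⟩`. -/
def formOpAdj (hA : IsAdmissible A) : FormSpace hA →L[ℝ] FormDual hA := (formOp hA).flip

end Operator

/-! ### Bochner spaces on the time interval `[0, T]` -/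

section Time

/-- Lebesgue measure on `[0, T]`. -/
abbrev timeMeasure (T : ℝ) : Measure ℝ := volume.restrict (Icc 0 T)

variable {E : Type*} [NormedAddCommGroup E] [NormedSpace ℝ E]

/-- `g` is the weak derivative of `w` on `(0, T)`:
`∫ φ'(t) w(t) dt = - ∫ φ(t) g(t) dt` for all test functions `φ ∈ C_c^∞(0, T)`. -/
def HasWeakDeriv (T : ℝ) (w g : ℝ → E) : Prop :=
  ∀ φ : ℝ → ℝ, ContDiff ℝ ∞ φ → HasCompactSupport φ → tsupport φ ⊆ Ioo 0 T →
    ∫ t, deriv φ t • w t ∂timeMeasure T = -∫ t, φ t • g t ∂timeMeasure T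

/-- The continuous representative of `w` on `[0, T]` vanishes at `T`. -/
def VanishesAtEnd (T : ℝ) (w : ℝ → E) : Prop :=
  ∃ c : ℝ → E, ContinuousOn c (Icc 0 T) ∧ c =ᵐ[timeMeasure T] w ∧ c T = 0

variable {H : Type*} [NormedAddCommGroup H] [InnerProductSpace ℝ H] [CompleteSpace H]
  {A : H →ₗ.[ℝ] H}

/-- `𝒳 = L²(0, T; V)`. -/
abbrev SpaceX (hA : IsAdmissible A) (T : ℝ) : Type _ := Lp (FormSpace hA) 2 (timeMeasure T)

/-- `L²(0, T; V*)`. -/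
abbrev SpaceXDual (hA : IsAdmissible A) (T : ℝ) : Type _ := Lp (FormDual hA) 2 (timeMeasure T)

theorem integrable_smul_of_test {T : ℝ} {w : ℝ → E} (hw : MemLp w 2 (timeMeasure T))
    {φ : ℝ → ℝ} (hφ : Continuous φ) (hc : HasCompactSupport φ) :
    Integrable (fun t => φ t • w t) (timeMeasure T) := by
  obtain ⟨C, hC⟩ := hφ.bounded_above_of_compact_support hc
  exact (hw.integrable (by norm_num)).bdd_smul C hφ.aestronglyMeasurable (.of_forall hC)

/-- `𝒴 = L²(0, T; V) ∩ H¹_{0,{T}}(0, T; V*)`, as a subspace of `L²(0, T; V)`. -/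
def SpaceY (hA : IsAdmissible A) (T : ℝ) : Submodule ℝ (SpaceX hA T) where
  carrier := {v | (∃ g : SpaceXDual hA T, HasWeakDeriv T (fun t => toDual hA (v t)) g) ∧
    VanishesAtEnd T (fun t => toDual hA (v t))}
  zero_mem' := by
    have h0 : (fun t => toDual hA ((0 : SpaceX hA T) t)) =ᵐ[timeMeasure T] 0 := by
      filter_upwards [Lp.coeFn_zero (FormSpace hA) 2 (timeMeasure T)] with t ht
      rw [ht, Pi.zero_apply, map_zero, Pi.zero_apply]
    refine ⟨⟨0, fun φ _ _ _ => ?_⟩, 0, continuousOn_const, h0.symm, rfl⟩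
    rw [integral_eq_zero_of_ae, integral_eq_zero_of_ae, neg_zero]
    · filter_upwards [Lp.coeFn_zero (FormDual hA) 2 (timeMeasure T)] with t ht
      rw [ht, Pi.zero_apply, smul_zero]
    · filter_upwards [h0] with t ht
      rw [ht, Pi.zero_apply, smul_zero]
  add_mem' := by
    rintro v₁ v₂ ⟨⟨g₁, hg₁⟩, c₁, hc₁, he₁, hT₁⟩ ⟨⟨g₂, hg₂⟩, c₂, hc₂, he₂, hT₂⟩
    have hadd : (fun t => toDual hA ((v₁ + v₂ : SpaceX hA T) t)) =ᵐ[timeMeasure T]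
        fun t => toDual hA (v₁ t) + toDual hA (v₂ t) := by
      filter_upwards [Lp.coeFn_add v₁ v₂] with t ht
      rw [ht, Pi.add_apply, map_add]
    refine ⟨⟨g₁ + g₂, fun φ h1 h2 h3 => ?_⟩, c₁ + c₂, hc₁.add hc₂, ?_, by simp [hT₁, hT₂]⟩
    · have hd : Continuous (deriv φ) := h1.continuous_deriv (by norm_num)
      have e1 : ∫ t, deriv φ t • toDual hA ((v₁ + v₂ : SpaceX hA T) t) ∂timeMeasure T =
          ∫ t, (deriv φ t • toDual hA (v₁ t) + deriv φ t • toDual hA (v₂ t))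
            ∂timeMeasure T := by
        refine integral_congr_ae ?_
        filter_upwards [hadd] with t ht
        rw [ht, smul_add]
      have e2 : ∫ t, φ t • (g₁ + g₂ : SpaceXDual hA T) t ∂timeMeasure T =
          ∫ t, (φ t • g₁ t + φ t • g₂ t) ∂timeMeasure T := by
        refine integral_congr_ae ?_
        filter_upwards [Lp.coeFn_add g₁ g₂] with t ht
        rw [ht, Pi.add_apply, smul_add]
      have m1 : MemLp (fun t => toDual hA (v₁ t)) 2 (timeMeasure T) :=
        (toDual hA).comp_memLp' (Lp.memLp v₁)
      have m2 : MemLp (fun t => toDual hA (v₂ t)) 2 (timeMeasure T) :=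
        (toDual hA).comp_memLp' (Lp.memLp v₂)
      rw [e1, e2, integral_add (integrable_smul_of_test m1 hd h2.deriv)
        (integrable_smul_of_test m2 hd h2.deriv),
        integral_add (integrable_smul_of_test (Lp.memLp g₁) h1.continuous h2)
        (integrable_smul_of_test (Lp.memLp g₂) h1.continuous h2),
        hg₁ φ h1 h2 h3, hg₂ φ h1 h2 h3, neg_add]
    · filter_upwards [hadd, he₁, he₂] with t h h1 h2
      rw [h, Pi.add_apply, h1, h2]
  smul_mem' := by
    rintro a v ⟨⟨g, hg⟩, c, hc, he, hT⟩
    have hsm : (fun t => toDual hA ((a • v : SpaceX hA T) t)) =ᵐ[timeMeasure T]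
        fun t => a • toDual hA (v t) := by
      filter_upwards [Lp.coeFn_smul a v] with t ht
      rw [ht, Pi.smul_apply, map_smul]
    refine ⟨⟨a • g, fun φ h1 h2 h3 => ?_⟩, a • c, hc.const_smul a, ?_, by simp [hT]⟩
    · have e1 : ∫ t, deriv φ t • toDual hA ((a • v : SpaceX hA T) t) ∂timeMeasure T =
          ∫ t, a • (deriv φ t • toDual hA (v t)) ∂timeMeasure T := by
        refine integral_congr_ae ?_
        filter_upwards [hsm] with t ht
        rw [ht, smul_comm]
      have e2 : ∫ t, φ t • (a • g : SpaceXDual hA T) t ∂timeMeasure T =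
          ∫ t, a • (φ t • g t) ∂timeMeasure T := by
        refine integral_congr_ae ?_
        filter_upwards [Lp.coeFn_smul a g] with t ht
        rw [ht, Pi.smul_apply, smul_comm]
      rw [e1, e2, integral_smul, integral_smul, hg φ h1 h2 h3, smul_neg]
    · filter_upwards [hsm, he] with t h h1
      rw [h, Pi.smul_apply, h1]

/-- Weak derivatives in `L²(0, T; E)` are unique. -/
theorem HasWeakDeriv.unique [CompleteSpace E] {T : ℝ} {w : ℝ → E} {g₁ g₂ : Lp E 2 (timeMeasure T)}
    (h₁ : HasWeakDeriv T w g₁) (h₂ : HasWeakDeriv T w g₂) : g₁ = g₂ := by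
  have hi : ∀ g : Lp E 2 (timeMeasure T), Integrable g (timeMeasure T) := fun g =>
    (Lp.memLp g).integrable (by norm_num)
  have hloc : LocallyIntegrableOn (fun t => g₁ t - g₂ t) (Ioo 0 T) volume :=
    IntegrableOn.locallyIntegrableOn (((hi g₁).sub (hi g₂)).mono_measure
      (Measure.restrict_mono Ioo_subset_Icc_self le_rfl))
  have hz := isOpen_Ioo.ae_eq_zero_of_integral_contDiff_smul_eq_zero hloc (by
    intro φ h1 h2 h3
    have e := (h₁ φ h1 h2 h3).symm.trans (h₂ φ h1 h2 h3)
    have e' : ∫ t, φ t • (g₁ t - g₂ t) ∂timeMeasure T = 0 := by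
      simp_rw [smul_sub]
      rw [integral_sub (integrable_smul_of_test (Lp.memLp g₁) h1.continuous h2)
        (integrable_smul_of_test (Lp.memLp g₂) h1.continuous h2)]
      rw [neg_inj] at e
      rw [e, sub_self]
    rw [← e', setIntegral_eq_integral_of_forall_compl_eq_zero]
    intro t ht
    have : φ t = 0 := by
      by_contra h0
      exact ht (Ioo_subset_Icc_self (h3 (subset_tsupport φ h0)))
    rw [this, zero_smul])
  apply Lp.ext
  have hIoo : timeMeasure T = volume.restrict (Ioo 0 T) := Measure.restrict_congr_set Ioo_ae_eq_Icc.symm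
  have : ∀ᵐ t ∂volume.restrict (Ioo 0 T), g₁ t - g₂ t = 0 :=
    (ae_restrict_iff' measurableSet_Ioo).2 hz
  rw [← hIoo] at this
  filter_upwards [this] with t ht
  exact sub_eq_zero.1 ht

variable {hA : IsAdmissible A} {T : ℝ}

/-- The weak time derivative `∂ₜ v ∈ L²(0, T; V*)` of `v ∈ 𝒴`. -/
def timeDeriv (v : SpaceY hA T) : SpaceXDual hA T := v.2.1.choose

theorem timeDeriv_spec (v : SpaceY hA T) :
    HasWeakDeriv T (fun t => toDual hA ((v : SpaceX hA T) t)) (timeDeriv v) :=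
  v.2.1.choose_spec

/-- The norm of `𝒴`, `‖v‖_𝒴² = ‖v‖²_{L²(0,T;V)} + ‖∂ₜ v‖²_{L²(0,T;V*)}`, which is induced by the
inner product `⟪v₁, v₂⟫_{L²(0,T;V)} + ⟪∂ₜ v₁, ∂ₜ v₂⟫_{L²(0,T;V*)}`. -/
def normY (v : SpaceY hA T) : ℝ := √(‖(v : SpaceX hA T)‖ ^ 2 + ‖timeDeriv v‖ ^ 2)

/-- `ℬ(u, v) = ∫₀ᵀ ⟨u(t), (-∂ₜ + A*) v(t)⟩ dt`. -/
def bilinB (u : SpaceX hA T) (v : SpaceY hA T) : ℝ :=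
  ∫ t, (-(timeDeriv v t) + formOpAdj hA ((v : SpaceX hA T) t)) (u t) ∂timeMeasure T

/-- The inf-sup constant `β = inf_{u ≠ 0} sup_{v ≠ 0} ℬ(u, v) / (‖u‖_𝒳 ‖v‖_𝒴)`, formed in the
extended real line. -/
def infSupConst (hA : IsAdmissible A) (T : ℝ) : EReal :=
  ⨅ (u : SpaceX hA T) (_ : u ≠ 0), ⨆ (v : SpaceY hA T) (_ : v ≠ 0),
    ((bilinB u v / (‖u‖ * normY v) : ℝ) : EReal)

end Time

end SpaceTimeParabolic

end

/-! Write `J : V → H` for the embedding. The operator `J* J` on `V` is `A⁻¹`, and by Riesz it turns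
the pairing of `V` with `V*` into the inner product of `V`. For a `C¹` function `v` with `v(T) = 0`
this gives `ℬ(u, v) = ⟪S v, u⟫_𝒳` with `S v = v - A⁻¹ ∂ₜ v` (`bilinB_toSpaceY`).

Two facts about `S` suffice. First, `‖v‖_𝒴 ≤ ‖S v‖_𝒳` (`normY_toSpaceY_le`). Expanding the square
leaves `‖v‖_𝒴²` and the cross term `-2 ∫ ⟪∂ₜ v, v⟫_H dt = ‖v(0)‖_H² ≥ 0`. Second, `S` has dense
range in `𝒳` (`denseRange_backwardOp`), because along an eigenvector of `A⁻¹` the equation `S v = f`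
is a scalar ODE with an explicit solution.

Given `u ≠ 0`, take `v` with `S v` close to `u`. Then `ℬ(u, v)` is close to `‖u‖ ‖S v‖`, which is at
least `‖u‖ ‖v‖_𝒴`, so the quotient exceeds every `c < 1`. Density lets smooth `v` suffice, so
neither the solvability of the backward problem in `𝒴` nor integration by parts there is needed. -/

open MeasureTheory Set
open scoped ContDiff RealInnerProductSpace ENNReal

noncomputable section

namespace SpaceTimeParabolic

universe u

/-! ### The inverse of `A` on `V`: Riesz representation and eigenvectors. -/

section InverseOnFormSpace

variable {H : Type u} [NormedAddCommGroup H] [InnerProductSpace ℝ H] [CompleteSpace H]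
  {A : H →ₗ.[ℝ] H} (hA : IsAdmissible A)

/-- `A⁻¹` as a bounded operator on `V`. -/
def formInverse : FormSpace hA →L[ℝ] FormSpace hA :=
  ContinuousLinearMap.adjoint (toPivot hA) ∘L toPivot hA

theorem inner_formInverse_left (φ ψ : FormSpace hA) :
    ⟪formInverse hA φ, ψ⟫ = ⟪toPivot hA φ, toPivot hA ψ⟫ := by
  rw [formInverse, ContinuousLinearMap.comp_apply, ContinuousLinearMap.adjoint_inner_left]

theorem toDual_apply_eq_inner (φ ψ : FormSpace hA) :
    toDual hA φ ψ = ⟪formInverse hA φ, ψ⟫ :=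
  (inner_formInverse_left hA φ ψ).symm

theorem formOpAdj_apply_eq_inner (φ ψ : FormSpace hA) : formOpAdj hA φ ψ = ⟪φ, ψ⟫ := by
  rw [real_inner_comm]
  rfl

/-- The Riesz isometry sends `toDual hA φ` to `A⁻¹ φ`. This trades the `V*` norm of a time
derivative for a `V` norm, where squares can be expanded. -/
theorem norm_toDual (φ : FormSpace hA) : ‖toDual hA φ‖ = ‖formInverse hA φ‖ := by
  have h : toDual hA φ = innerSL ℝ (formInverse hA φ) := by
    ext ψ
    exact toDual_apply_eq_inner hA φ ψ
  rw [h, innerSL_apply_norm]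

theorem toPivot_apply (φ : FormSpace hA) : toPivot hA φ = invSqrt hA (sqrtOp hA φ) :=
  (invSqrt_sqrtOp hA φ).symm

/-- The isometry `A^{1/2} : V → H` conjugates the two versions of `A⁻¹`, so the eigenbasis in `H`
can be transported to `V`. -/
theorem sqrtOp_formInverse (φ : FormSpace hA) :
    sqrtOp hA (formInverse hA φ) = inverseOp hA (sqrtOp hA φ) := by
  refine ext_inner_right ℝ fun y => ?_
  obtain ⟨ψ, rfl⟩ := (sqrtOp hA).surjective y
  rw [← FormSpace.inner_def, inner_formInverse_left, toPivot_apply, toPivot_apply,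
    ← invSqrt_comp_self hA]
  exact ((invSqrt_isPositive hA).isSymmetric _ _).symm

/-- The eigenvectors of `A⁻¹` with positive eigenvalue are total in `V`. -/
theorem eq_zero_of_inner_eigenvector_eq_zero {y : FormSpace hA}
    (hy : ∀ (e : FormSpace hA) (m : ℝ), 0 < m → formInverse hA e = m • e → ⟪e, y⟫ = 0) :
    y = 0 := by
  obtain ⟨ι, b, m, hb⟩ := exists_eigenbasis (inverseOp_compact hA)
    (inverseOp_isPositive hA).isSymmetric
  have hinj : Function.Injective (inverseOp hA) := by
    rw [← invSqrt_comp_self hA]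
    exact (invSqrt_injective hA).comp (invSqrt_injective hA)
  -- Positivity of `A⁻¹` gives `0 ≤ m i`; injectivity excludes `0`. Strictness is needed because the
  -- scalar ODE divides by `m`.
  have hm : ∀ i, 0 < m i := by
    intro i
    have h1 : 0 ≤ ⟪inverseOp hA (b i), b i⟫ := by
      simpa using (inverseOp_isPositive hA).re_inner_nonneg_left (b i)
    rw [hb, inner_smul_left, real_inner_self_eq_norm_sq, b.orthonormal.1 i] at h1
    refine lt_of_le_of_ne (by simpa using h1) fun h0 => b.orthonormal.ne_zero i (hinj ?_)
    rw [hb, ← h0, zero_smul, map_zero]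
  have hz : sqrtOp hA y = 0 := by
    apply b.repr.injective
    ext i
    -- The eigenvectors in `V` are `A^{-1/2} b i`; pairing with them reads off the coordinates of
    -- `A^{1/2} y`.
    have h1 := hy ((sqrtOp hA).symm (b i)) (m i) (hm i) (by
      apply (sqrtOp hA).injective
      rw [sqrtOp_formInverse, map_smul, LinearEquiv.apply_symm_apply, hb])
    rw [FormSpace.inner_def, LinearEquiv.apply_symm_apply] at h1
    rw [b.repr_apply_apply, h1, map_zero]
    rfl
  exact (sqrtOp hA).map_eq_zero_iff.1 hz

end InverseOnFormSpace

/-! ### Calculus on the time interval: weak derivatives and a scalar terminal value problem. -/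

section Continuous

variable {E : Type*} [NormedAddCommGroup E] {T : ℝ}

theorem _root_.Continuous.memLp_timeMeasure {f : ℝ → E} (hf : Continuous f) (T : ℝ) :
    MemLp f 2 (timeMeasure T) := by
  obtain ⟨C, hC⟩ := isCompact_Icc.exists_bound_of_continuousOn (hf.continuousOn (s := Icc 0 T))
  exact MemLp.of_bound hf.aestronglyMeasurable C
    ((ae_restrict_iff' measurableSet_Icc).2 (.of_forall hC))

variable [NormedSpace ℝ E]

theorem integral_timeMeasure (hT : 0 ≤ T) (f : ℝ → E) :
    ∫ t, f t ∂timeMeasure T = ∫ t in (0)..T, f t := by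
  rw [intervalIntegral.integral_of_le hT, integral_Icc_eq_integral_Ioc]

/-- A classical derivative is a weak derivative. -/
theorem hasWeakDeriv_of_hasDerivAt [CompleteSpace E] (hT : 0 ≤ T) {w g : ℝ → E}
    (hw : ∀ t, HasDerivAt w (g t) t) (hg : Continuous g) : HasWeakDeriv T w g := by
  intro φ h1 h2 h3
  have hd : Continuous (deriv φ) := h1.continuous_deriv (by norm_num)
  have hz : ∀ t, t ∉ Ioo 0 T → φ t = 0 := fun t ht => by
    by_contra h0
    exact ht (h3 (subset_tsupport φ h0))
  have h := intervalIntegral.integral_smul_deriv_eq_deriv_smul (a := 0) (b := T)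
    (u := φ) (u' := deriv φ) (v := w) (v' := g)
    (fun t _ => (h1.differentiable (by norm_num) t).hasDerivAt) (fun t _ => hw t)
    (hd.intervalIntegrable _ _) (hg.intervalIntegrable _ _)
  -- The boundary terms vanish because the support of `φ` lies in the open interval.
  rw [hz 0 (by simp), hz T (by simp)] at h
  rw [integral_timeMeasure hT, integral_timeMeasure hT, h]
  simp

/-- The terminal value problem `g - m g' = f`, `g(T) = 0`. -/
theorem exists_terminalValue_solution {m : ℝ} (hm : 0 < m) (T : ℝ) {f : ℝ → ℝ}
    (hf : Continuous f) :
    ∃ g : ℝ → ℝ, ContDiff ℝ 1 g ∧ g T = 0 ∧ ∀ t, g t - m * deriv g t = f t := by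
  have hc : Continuous fun s => Real.exp (-(s / m)) * (f s / m) := by fun_prop
  -- Variation of constants, integrating from `T` to build in the terminal condition: the solution
  -- is `-exp (t / m) * F t`.
  let F : ℝ → ℝ := fun t => ∫ s in T..t, Real.exp (-(s / m)) * (f s / m)
  have hF : ∀ t, HasDerivAt F (Real.exp (-(t / m)) * (f t / m)) t := fun t =>
    hc.integral_hasStrictDerivAt T t |>.hasDerivAt
  have hE : ∀ t : ℝ, HasDerivAt (fun t => Real.exp (t / m)) (Real.exp (t / m) * (1 / m)) t :=
    fun t => ((hasDerivAt_id t).div_const m).exp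
  have hg : ∀ t, HasDerivAt (fun t => -(Real.exp (t / m) * F t))
      ((-(Real.exp (t / m) * F t) - f t) / m) t := by
    intro t
    refine ((hE t).mul (hF t)).neg.congr_deriv ?_
    have h1 : Real.exp (t / m) * Real.exp (-(t / m)) = 1 := by
      rw [← Real.exp_add, add_neg_cancel, Real.exp_zero]
    linear_combination (-(f t / m)) * h1
  have hFc : Continuous F := continuous_iff_continuousAt.2 fun t => (hF t).continuousAt
  refine ⟨_, contDiff_one_iff_deriv.2 ⟨fun t => (hg t).differentiableAt, ?_⟩, ?_, fun t => ?_⟩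
  · rw [funext fun t => (hg t).deriv]
    fun_prop
  · simp [F]
  · rw [(hg t).deriv]
    field_simp
    ring

end Continuous

/-! ### The preconditioned backward operator on smooth test functions. -/

section Classical

variable {H : Type u} [NormedAddCommGroup H] [InnerProductSpace ℝ H] [CompleteSpace H]
  {A : H →ₗ.[ℝ] H} (hA : IsAdmissible A) (T : ℝ)

/-- The `C¹` functions `ℝ → V` that vanish at `T`. -/
def classicalTest : Submodule ℝ (ℝ → FormSpace hA) where
  carrier := {v | ContDiff ℝ 1 v ∧ v T = 0}
  zero_mem' := ⟨contDiff_const, rfl⟩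
  add_mem' := fun ⟨h1, h2⟩ ⟨h3, h4⟩ => ⟨h1.add h3, by simp [h2, h4]⟩
  smul_mem' := fun c _ ⟨h1, h2⟩ => ⟨contDiff_const.smul h1, by simp [h2]⟩

/-- The type of `C¹` functions `ℝ → V` that vanish at `T`. -/
abbrev ClassicalTest : Type _ := classicalTest hA T

variable {hA T}

namespace ClassicalTest

theorem hasDerivAt (v : ClassicalTest hA T) (t : ℝ) :
    HasDerivAt (v : ℝ → FormSpace hA) (deriv v.1 t) t :=
  (v.2.1.differentiable (by norm_num) t).hasDerivAt

theorem continuous (v : ClassicalTest hA T) : Continuous (v : ℝ → FormSpace hA) :=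
  v.2.1.continuous

theorem continuous_deriv (v : ClassicalTest hA T) : Continuous (deriv v.1) :=
  v.2.1.continuous_deriv (by norm_num)

theorem memLp (v : ClassicalTest hA T) : MemLp (v : ℝ → FormSpace hA) 2 (timeMeasure T) :=
  v.continuous.memLp_timeMeasure T

theorem memLp_inverse_deriv (v : ClassicalTest hA T) :
    MemLp (fun t => formInverse hA (deriv v.1 t)) 2 (timeMeasure T) :=
  ((formInverse hA).continuous.comp v.continuous_deriv).memLp_timeMeasure T

theorem memLp_toDual_deriv (v : ClassicalTest hA T) :
    MemLp (fun t => toDual hA (deriv v.1 t)) 2 (timeMeasure T) :=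
  ((toDual hA).continuous.comp v.continuous_deriv).memLp_timeMeasure T

variable (hA T) in
/-- The preconditioned backward parabolic operator `v ↦ v - A⁻¹ ∂ₜ v`. -/
def backwardOp : ClassicalTest hA T →ₗ[ℝ] SpaceX hA T where
  toFun v := v.memLp.toLp _ - v.memLp_inverse_deriv.toLp _
  map_add' v w := by
    have h : (v + w).memLp_inverse_deriv.toLp _ =
        v.memLp_inverse_deriv.toLp _ + w.memLp_inverse_deriv.toLp _ := by
      rw [← MemLp.toLp_add]
      congr 1
      ext1 t
      rw [Pi.add_apply, ← map_add, ← ((v.hasDerivAt t).add (w.hasDerivAt t)).deriv]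
      rfl
    have h2 : (v + w).memLp.toLp _ = v.memLp.toLp _ + w.memLp.toLp _ :=
      MemLp.toLp_add v.memLp w.memLp
    rw [h, h2]
    abel
  map_smul' c v := by
    have h : (c • v).memLp_inverse_deriv.toLp _ = c • v.memLp_inverse_deriv.toLp _ := by
      rw [← MemLp.toLp_const_smul]
      congr 1
      ext1 t
      rw [Pi.smul_apply, ← map_smul, ← ((v.hasDerivAt t).const_smul c).deriv]
      rfl
    rw [h, RingHom.id_apply, smul_sub, ← MemLp.toLp_const_smul]
    rfl

theorem backwardOp_apply (v : ClassicalTest hA T) :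
    backwardOp hA T v = v.memLp.toLp _ - v.memLp_inverse_deriv.toLp _ := rfl

theorem coeFn_backwardOp (v : ClassicalTest hA T) :
    backwardOp hA T v =ᵐ[timeMeasure T] fun t => v.1 t - formInverse hA (deriv v.1 t) := by
  rw [backwardOp_apply]
  filter_upwards [Lp.coeFn_sub (v.memLp.toLp _) (v.memLp_inverse_deriv.toLp _),
    v.memLp.coeFn_toLp, v.memLp_inverse_deriv.coeFn_toLp] with t h1 h2 h3
  rw [h1, Pi.sub_apply, h2, h3]

/-- A solution of the backward equation for the data `f(t) e` with an eigenvector `e`. -/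
theorem exists_backwardOp_eq_smul {e : FormSpace hA} {m : ℝ} (hm : 0 < m)
    (he : formInverse hA e = m • e) {f : ℝ → ℝ} (hf : Continuous f) :
    ∃ v : ClassicalTest hA T, backwardOp hA T v =ᵐ[timeMeasure T] fun t => f t • e := by
  obtain ⟨g, hg, hgT, hgf⟩ := exists_terminalValue_solution hm T hf
  refine ⟨⟨fun t => g t • e, hg.smul contDiff_const, by simp [hgT]⟩, ?_⟩
  refine (coeFn_backwardOp _).trans (.of_forall fun t => ?_)
  have hd : deriv (fun t => g t • e) t = deriv g t • e :=
    ((hg.differentiable (by norm_num) t).hasDerivAt.smul_const e).deriv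
  simp only [hd, map_smul, he, smul_smul, ← sub_smul, ← hgf t, mul_comm m]

/-- Let `u` be orthogonal to the range. Testing with the solution for data `φ(t) e`, `e` an
eigenvector, shows that `∫ φ u` is orthogonal to `e`. Eigenvectors are total, so `∫ φ u = 0` for
every test function `φ`, and `u = 0` by the fundamental lemma of the calculus of variations. -/
theorem denseRange_backwardOp : DenseRange (backwardOp hA T) := by
  have h : (LinearMap.range (backwardOp hA T))ᗮ = ⊥ := by
    rw [Submodule.eq_bot_iff]
    intro u hu
    have hui : Integrable u (timeMeasure T) := (Lp.memLp u).integrable (by norm_num)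
    have hIoo : timeMeasure T = volume.restrict (Ioo 0 T) :=
      Measure.restrict_congr_set Ioo_ae_eq_Icc.symm
    have hloc : LocallyIntegrableOn u (Ioo 0 T) volume :=
      IntegrableOn.locallyIntegrableOn (hui.mono_measure
        (Measure.restrict_mono Ioo_subset_Icc_self le_rfl))
    have hz := isOpen_Ioo.ae_eq_zero_of_integral_contDiff_smul_eq_zero hloc (by
      intro φ h1 h2 h3
      have hint := integrable_smul_of_test (Lp.memLp u) h1.continuous h2
      rw [← setIntegral_eq_integral_of_forall_compl_eq_zero (s := Icc 0 T) (fun t ht => by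
        have : φ t = 0 := by
          by_contra h0
          exact ht (Ioo_subset_Icc_self (h3 (subset_tsupport φ h0)))
        rw [this, zero_smul])]
      refine eq_zero_of_inner_eigenvector_eq_zero hA fun e m hm he => ?_
      obtain ⟨v, hv⟩ := exists_backwardOp_eq_smul (T := T) hm he h1.continuous
      have h4 := (Submodule.mem_orthogonal _ _).1 hu _ ⟨v, rfl⟩
      rw [L2.inner_def] at h4
      rw [← integral_inner hint, ← h4]
      refine integral_congr_ae ?_
      filter_upwards [hv] with t ht
      rw [ht, inner_smul_left, inner_smul_right]
      rfl)
    apply Lp.ext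
    have : ∀ᵐ t ∂volume.restrict (Ioo 0 T), u t = 0 :=
      (ae_restrict_iff' measurableSet_Ioo).2 hz
    rw [← hIoo] at this
    filter_upwards [this, Lp.coeFn_zero (FormSpace hA) 2 (timeMeasure T)] with t h5 h6
    rw [h5, h6, Pi.zero_apply]
  have h2 := (Submodule.topologicalClosure_eq_top_iff).2 h
  have h3 := Submodule.dense_iff_topologicalClosure_eq_top.2 h2
  rwa [LinearMap.coe_range] at h3

theorem hasWeakDeriv (hT : 0 ≤ T) (v : ClassicalTest hA T) :
    HasWeakDeriv T (fun t => toDual hA (v.memLp.toLp _ t))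
      (v.memLp_toDual_deriv.toLp (fun t => toDual hA (deriv v.1 t))) := by
  intro φ h1 h2 h3
  have h := hasWeakDeriv_of_hasDerivAt hT
    (fun t => (toDual hA).hasFDerivAt.comp_hasDerivAt t (v.hasDerivAt t))
    ((toDual hA).continuous.comp v.continuous_deriv) φ h1 h2 h3
  refine Eq.trans (integral_congr_ae ?_) (h.trans (congrArg Neg.neg (integral_congr_ae ?_)))
  · filter_upwards [v.memLp.coeFn_toLp] with t ht
    rw [ht]
    rfl
  · filter_upwards [v.memLp_toDual_deriv.coeFn_toLp] with t ht
    rw [ht]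

/-- A classical test function as an element of `𝒴`. -/
def toSpaceY (hT : 0 ≤ T) (v : ClassicalTest hA T) : SpaceY hA T :=
  ⟨v.memLp.toLp _, ⟨_, v.hasWeakDeriv hT⟩, fun t => toDual hA (v.1 t),
    ((toDual hA).continuous.comp v.continuous).continuousOn, by
      filter_upwards [v.memLp.coeFn_toLp] with t ht
      rw [ht], by simp [v.2.2]⟩

/-- `timeDeriv` is a chosen witness; uniqueness of weak derivatives identifies it with the classical
derivative. -/
theorem timeDeriv_toSpaceY (hT : 0 ≤ T) (v : ClassicalTest hA T) :
    timeDeriv (v.toSpaceY hT) =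
      v.memLp_toDual_deriv.toLp (fun t => toDual hA (deriv v.1 t)) :=
  (timeDeriv_spec _).unique (v.hasWeakDeriv hT)

theorem bilinB_toSpaceY (hT : 0 ≤ T) (u : SpaceX hA T) (v : ClassicalTest hA T) :
    bilinB u (v.toSpaceY hT) = ⟪backwardOp hA T v, u⟫ := by
  rw [bilinB, timeDeriv_toSpaceY, L2.inner_def]
  refine integral_congr_ae ?_
  filter_upwards [coeFn_backwardOp v, v.memLp.coeFn_toLp,
    v.memLp_toDual_deriv.coeFn_toLp] with t h1 h2 h3
  change (-(v.memLp_toDual_deriv.toLp _ t) + formOpAdj hA (v.memLp.toLp _ t)) (u t) = _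
  rw [h1, h2, h3, add_apply, neg_apply,
    toDual_apply_eq_inner, formOpAdj_apply_eq_inner, inner_sub_left]
  ring

/-- Since `⟪A⁻¹ v', v⟫_V = ⟪v', v⟫_H` is half the derivative of `‖v‖_H²`, the integral equals
`-‖v(0)‖_H² / 2` by `v(T) = 0`. -/
theorem inner_inverse_deriv_nonpos (hT : 0 ≤ T) (v : ClassicalTest hA T) :
    ⟪v.memLp_inverse_deriv.toLp _, v.memLp.toLp _⟫ ≤ 0 := by
  let J := toPivot hA
  have hJ : ∀ t, HasDerivAt (fun t => J (v.1 t)) (J (deriv v.1 t)) t := fun t =>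
    J.hasFDerivAt.comp_hasDerivAt t (v.hasDerivAt t)
  have hd : ∀ t, HasDerivAt (fun t => ‖J (v.1 t)‖ ^ 2)
      (2 * ⟪J (deriv v.1 t), J (v.1 t)⟫) t := fun t => by
    rw [real_inner_comm]
    exact (hJ t).norm_sq
  have hc : Continuous fun t => 2 * ⟪J (deriv v.1 t), J (v.1 t)⟫ :=
    continuous_const.mul ((J.continuous.comp v.continuous_deriv).inner
      (J.continuous.comp v.continuous))
  have hI := intervalIntegral.integral_eq_sub_of_hasDerivAt (a := 0) (b := T)
    (fun t _ => hd t) (hc.intervalIntegrable _ _)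
  have he : ⟪v.memLp_inverse_deriv.toLp _, v.memLp.toLp _⟫ =
      ∫ t in (0)..T, ⟪J (deriv v.1 t), J (v.1 t)⟫ := by
    rw [L2.inner_def, ← integral_timeMeasure hT]
    refine integral_congr_ae ?_
    filter_upwards [v.memLp.coeFn_toLp, v.memLp_inverse_deriv.coeFn_toLp] with t h1 h2
    rw [h1, h2, inner_formInverse_left]
  rw [intervalIntegral.integral_const_mul, v.2.2, map_zero] at hI
  rw [he]
  have : 0 ≤ ‖J (v.1 0)‖ ^ 2 := by positivity
  simp at hI
  linarith

/-- Energy estimate: the backward operator does not decrease the norm of `𝒴`. -/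
theorem normY_toSpaceY_le (hT : 0 ≤ T) (v : ClassicalTest hA T) :
    normY (v.toSpaceY hT) ≤ ‖backwardOp hA T v‖ := by
  have h1 : ‖timeDeriv (v.toSpaceY hT)‖ ≤ ‖v.memLp_inverse_deriv.toLp _‖ := by
    rw [timeDeriv_toSpaceY]
    refine Lp.norm_le_norm_of_ae_le ?_
    filter_upwards [v.memLp_toDual_deriv.coeFn_toLp, v.memLp_inverse_deriv.coeFn_toLp]
      with t h1 h2
    rw [h1, h2, norm_toDual]
  have h2 : ‖((v.toSpaceY hT : SpaceY hA T) : SpaceX hA T)‖ = ‖v.memLp.toLp _‖ := rfl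
  refine Real.sqrt_le_iff.2 ⟨norm_nonneg _, ?_⟩
  rw [backwardOp_apply, norm_sub_sq_real, h2]
  have h3 := inner_inverse_deriv_nonpos hT v
  rw [real_inner_comm] at h3
  have h4 := pow_le_pow_left₀ (norm_nonneg _) h1 2
  linarith

end ClassicalTest

/-! ### From density and the energy estimate to the inf-sup quotient. -/

theorem timeDeriv_zero : timeDeriv (0 : SpaceY hA T) = 0 := by
  refine (timeDeriv_spec _).unique fun φ _ _ _ => ?_
  rw [integral_eq_zero_of_ae, integral_eq_zero_of_ae, neg_zero]
  · filter_upwards [Lp.coeFn_zero (FormDual hA) 2 (timeMeasure T)] with t ht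
    rw [ht, Pi.zero_apply, smul_zero]
  · filter_upwards [Lp.coeFn_zero (FormSpace hA) 2 (timeMeasure T)] with t ht
    change deriv φ t • toDual hA ((0 : SpaceX hA T) t) = 0
    rw [ht, Pi.zero_apply, map_zero, smul_zero]

theorem bilinB_zero_right (u : SpaceX hA T) : bilinB u (0 : SpaceY hA T) = 0 := by
  refine integral_eq_zero_of_ae ?_
  rw [timeDeriv_zero]
  filter_upwards [Lp.coeFn_zero (FormDual hA) 2 (timeMeasure T),
    Lp.coeFn_zero (FormSpace hA) 2 (timeMeasure T)] with t h1 h2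
  change (-((0 : SpaceXDual hA T) t) + formOpAdj hA ((0 : SpaceX hA T) t)) (u t) = 0
  rw [h1, h2]
  simp

theorem normY_pos {v : SpaceY hA T} (hv : v ≠ 0) : 0 < normY v := by
  have h : 0 < ‖(v : SpaceX hA T)‖ := norm_pos_iff.2 fun h => hv (Subtype.ext h)
  exact Real.sqrt_pos.2 (by positivity)

/-- The inf-sup quotient comes arbitrarily close to `1`. -/
theorem exists_lt_bilinB_div (hT : 0 ≤ T) {u : SpaceX hA T} (hu : u ≠ 0) {c : ℝ} (hc : c < 1) :
    ∃ v : SpaceY hA T, v ≠ 0 ∧ c < bilinB u v / (‖u‖ * normY v) := by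
  have hu0 : 0 < ‖u‖ := norm_pos_iff.2 hu
  -- The wanted inequality, with `w` in place of `S v`, is an open condition that holds at `w = u`.
  -- Replacing `c` by `max c 0` makes the coefficient nonnegative, so that `‖S v‖` may later be
  -- lowered to `normY`, and it forces `ℬ(u, v) > 0`, hence `v ≠ 0`.
  have hlim : Filter.Tendsto (fun w : SpaceX hA T => ⟪w, u⟫ - max c 0 * (‖u‖ * ‖w‖)) (nhds u)
      (nhds (⟪u, u⟫ - max c 0 * (‖u‖ * ‖u‖))) := by
    have : Continuous fun w : SpaceX hA T => ⟪w, u⟫ - max c 0 * (‖u‖ * ‖w‖) := by fun_prop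
    exact this.tendsto u
  have hpos : 0 < ⟪u, u⟫ - max c 0 * (‖u‖ * ‖u‖) := by
    rw [real_inner_self_eq_norm_mul_norm]
    have h1 : max c 0 < 1 := max_lt hc one_pos
    have h2 : 0 < ‖u‖ * ‖u‖ := by positivity
    nlinarith
  obtain ⟨w, hw, v, rfl⟩ := mem_closure_iff_nhds.1 (ClassicalTest.denseRange_backwardOp u) _
    (hlim.eventually (lt_mem_nhds hpos))
  have hw' : max c 0 * (‖u‖ * ‖ClassicalTest.backwardOp hA T v‖) <
      bilinB u (v.toSpaceY hT) := by
    rw [ClassicalTest.bilinB_toSpaceY]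
    exact sub_pos.1 hw
  have hne : v.toSpaceY hT ≠ 0 := by
    intro h0
    rw [h0, bilinB_zero_right] at hw'
    exact absurd hw' (not_lt.2 (by positivity))
  refine ⟨_, hne, ?_⟩
  rw [lt_div_iff₀ (mul_pos hu0 (normY_pos hne))]
  refine lt_of_le_of_lt ?_ hw'
  have hn : 0 ≤ normY (v.toSpaceY hT) := (normY_pos hne).le
  have := v.normY_toSpaceY_le hT
  gcongr
  exact le_max_left _ _

end Classical

end SpaceTimeParabolic

end

theorem mainTheorem7 {H : Type*} [NormedAddCommGroup H] [InnerProductSpace ℝ H] [CompleteSpace H]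
    [TopologicalSpace.SeparableSpace H] (A : H →ₗ.[ℝ] H)
    (hA : SpaceTimeParabolic.IsAdmissible A) (T : ℝ) (hT : 0 < T) :
    1 ≤ SpaceTimeParabolic.infSupConst hA T := by
  refine le_iInf₂ fun u hu => le_of_forall_lt fun c hc => ?_
  induction c with
  | bot =>
    -- Only the existence of some `v ≠ 0` matters here: a supremum over the empty set would be `⊥`.
    obtain ⟨v, hv, -⟩ := SpaceTimeParabolic.exists_lt_bilinB_div hT.le hu zero_lt_one
    exact lt_of_lt_of_le (EReal.bot_lt_coe _) (le_iSup₂_of_le v hv le_rfl)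
  | coe c =>
    obtain ⟨v, hv, h⟩ := SpaceTimeParabolic.exists_lt_bilinB_div hT.le hu
      (EReal.coe_lt_coe_iff.1 hc : c < 1)
    exact lt_of_lt_of_le (EReal.coe_lt_coe_iff.2 h) (le_iSup₂_of_le v hv le_rfl)
  | top => exact absurd hc not_top_lt
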